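/- Ribbon graphs are considered up to isomorphism. Let $\mathfrak{S}=\langle \delta,\tau \mid \delta^2,\tau^2,(\tau\delta)^3\rangle$ act (on the left) on each edge of a ribbon graph, $\delta$ as the partial dual and $\tau$ as the partial Petrial (half-twist) at that edge. On ribbon graphs $(G,\ell)$ with $n$ linearly ordered edges (taken up to isomorphisms that respect the orderings), the semidirect product $\mathfrak{S}^n\rtimes S_n$ acts by $(\hat\gamma,\pi)(G,\ell)=\hat\gamma(G,\ell\pi^{-1})$, where $\hat\gamma=(g_1,\dots,g_n)$ applies $g_i$ to the $i$-th edge; $\iota$ is the identity of $S_n$. For $g\in\mathfrak S$, consider the condition that there is a $\pi\in S_n$ with $((g,\dots,g),\pi)(G,\ell)=(G,\ell)$, i.e. that applying $g$ to all edges of $G$ gives a ribbon graph isomorphic to $G$. The graph is called self-dual if this holds for $g=\delta$, self-Petrial if it holds for $g=\tau$, and self-trial if it holds for $g=\delta\tau$ (equivalently, for $g=\tau\delta$). For every integer $k\ge 1$, let $H_k$ be the orientable ribbon graph with a single vertex and $3k$ untwisted edges $e_1,\dots,e_{3k}$ (in this order), whose ends are attached around the vertex in the cyclic order $$e_2, e_1,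 e_3, e_2, e_4, e_3, \ldots, e_{i}, e_{i-1}, e_{i+1}, e_i, \ldots, e_{3k}, e_{3k-1}, e_1, e_{3k},$$ and let $$\hat\alpha=(\underbrace{1,\dots,1}_{k},\underbrace{\delta\tau,\dots,\delta\tau}_{k},\underbrace{\tau\delta,\dots,\tau\delta}_{k})\in\mathfrak S^{3k}.$$ Then the ribbon graph $(\hat\alpha,\iota)(H_k)$, which has $3k$ edges, is self-trial, but it is neither self-dual nor self-Petrial. -/

import Mathlib

/-! Ribbon graphs with ordered edges are handled through their arrow presentations: a collection of
disjoint circles carrying, for each edge, two directed arcs ("arrows"). The edges are indexed by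
their position in the linear ordering, so an arrow presentation on the edge set `Fin n` stands for
a pair `(G, ℓ)` with `ℓ` the given ordering. -/

namespace RibbonGraph

/-- The four ends of the two arrows of a single edge. The first entry says which of the two arrows
(`false`: arrow `a`, `true`: arrow `b`), the second one which end of it
(`false`: tail, `true`: head). -/
abbrev ArrowEnd : Type := Bool × Bool

/-- All arrow ends of an arrow presentation with `n` edges. -/
abbrev Point (n : ℕ) : Type := Fin n × ArrowEnd

/-- An arrow presentation with edges indexed by `Fin n`. Going round the circles one meets
alternately arrows and complementary arcs, and the circles are determined by the way in which the
complementary arcs match up the ends of the arrows; in addition there may be circles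
without arrows (isolated vertices). -/
@[ext]
structure ArrowPresentation (n : ℕ) where
  /-- the other end point of the complementary arc that begins at a given arrow end -/
  arc : Equiv.Perm (Point n)
  arc_arc : ∀ p, arc (arc p) = p
  arc_ne : ∀ p, arc p ≠ p
  /-- the number of circles without arrows -/
  bareCircles : ℕ

/-- Rename the arrow ends: the arrow end called `p` is now called `φ p`. In particular the arrows
of the new presentation join the points `φ⁻¹ (e, x, tail)` and `φ⁻¹ (e, x, head)` of the
old one. -/
def ArrowPresentation.relabel {n : ℕ} (φ : Equiv.Perm (Point n)) (P : ArrowPresentation n) :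
    ArrowPresentation n where
  arc := φ * P.arc * φ⁻¹
  arc_arc p := by simp [P.arc_arc]
  arc_ne p h := by
    apply P.arc_ne (φ⁻¹ p)
    apply φ.injective
    simpa using h
  bareCircles := P.bareCircles

theorem relabel_one {n : ℕ} (P : ArrowPresentation n) : P.relabel 1 = P := by
  ext1 <;> simp [ArrowPresentation.relabel]

theorem relabel_relabel {n : ℕ} (φ ψ : Equiv.Perm (Point n)) (P : ArrowPresentation n) :
    (P.relabel ψ).relabel φ = P.relabel (φ * ψ) := by
  ext1 <;> simp [ArrowPresentation.relabel, mul_assoc]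

/-- The arrow end `x` of the edge `e` is renamed as the arrow end `σ (π e) x` of the
edge `π e`. -/
def edgewise {n : ℕ} (π : Equiv.Perm (Fin n)) (σ : Fin n → Equiv.Perm ArrowEnd) :
    Equiv.Perm (Point n) :=
  Equiv.prodShear π (fun e => σ (π e))

@[simp] theorem edgewise_apply {n : ℕ} (π : Equiv.Perm (Fin n))
    (σ : Fin n → Equiv.Perm ArrowEnd) (p : Point n) :
    edgewise π σ p = (π p.1, σ (π p.1) p.2) := rfl

/-! ### Isomorphism of ribbon graphs with ordered edges -/

/-- The symmetries of the two arrows of one edge (the symmetries of the edge disc that preserve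
its pair of attaching segments): for `s = true` the names `a`, `b` of the two arrows are exchanged,
for `r = true` both arrows are reversed. -/
def arrowSymm (s r : Bool) : Equiv.Perm ArrowEnd where
  toFun x := (xor x.1 s, xor x.2 r)
  invFun x := (xor x.1 s, xor x.2 r)
  left_inv x := by simp
  right_inv x := by simp

@[simp] theorem arrowSymm_apply (s r : Bool) (x : ArrowEnd) :
    arrowSymm s r x = (xor x.1 s, xor x.2 r) := rfl

/-- Two arrow presentations represent isomorphic ribbon graphs with ordered edges if they differ
only by the names and the simultaneous reversal of the two arrows of some edges. (The circles carry
neither an orientation nor a base point, so that nothing else has to be divided out.) -/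
def ArrowPresentation.Iso {n : ℕ} (P Q : ArrowPresentation n) : Prop :=
  ∃ s r : Fin n → Bool, Q = P.relabel (edgewise 1 (fun e => arrowSymm (s e) (r e)))

theorem iso_refl {n : ℕ} (P : ArrowPresentation n) : P.Iso P := by
  refine ⟨fun _ => false, fun _ => false, ?_⟩
  have : edgewise (n := n) 1 (fun _ => arrowSymm false false) = 1 := by
    ext1 p; simp
  rw [this, relabel_one]

theorem iso_symm {n : ℕ} {P Q : ArrowPresentation n} (h : P.Iso Q) : Q.Iso P := by
  obtain ⟨s, r, rfl⟩ := h
  refine ⟨s, r, ?_⟩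
  rw [relabel_relabel]
  have : edgewise (n := n) 1 (fun e => arrowSymm (s e) (r e)) *
      edgewise 1 (fun e => arrowSymm (s e) (r e)) = 1 := by
    ext1 p; simp
  rw [this, relabel_one]

theorem iso_trans {n : ℕ} {P Q R : ArrowPresentation n} (h : P.Iso Q) (h' : Q.Iso R) :
    P.Iso R := by
  obtain ⟨s, r, rfl⟩ := h
  obtain ⟨s', r', rfl⟩ := h'
  refine ⟨fun e => xor (s e) (s' e), fun e => xor (r e) (r' e), ?_⟩
  rw [relabel_relabel]
  congr 1
  ext1 p; simp

instance isoSetoid (n : ℕ) : Setoid (ArrowPresentation n) where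
  r := ArrowPresentation.Iso
  iseqv := ⟨iso_refl, iso_symm, iso_trans⟩

/-- Equivalence classes, under isomorphism, of ribbon graphs with `n` linearly ordered edges. -/
def OrderedRibbonGraph (n : ℕ) : Type := Quotient (isoSetoid n)

/-! ### The ribbon group -/

/-- The two generators. -/
inductive Generator : Type
  | delta
  | tau

/-- The relators `δ²`, `τ²`, `(τδ)³`. -/
def ribbonRels : Set (FreeGroup Generator) :=
  {FreeGroup.of .delta ^ 2, FreeGroup.of .tau ^ 2,
    (FreeGroup.of .tau * FreeGroup.of .delta) ^ 3}

/-- The group `⟨δ, τ | δ², τ², (τδ)³⟩`. -/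
abbrev TwistGroup : Type := PresentedGroup ribbonRels

/-- The generator `δ` (partial dual). -/
def δ : TwistGroup := PresentedGroup.of .delta

/-- The generator `τ` (partial Petrial, or twist). -/
def τ : TwistGroup := PresentedGroup.of .tau

/-- How the arrow ends of an edge are renamed under the generators.

`τ` reverses exactly one of the two arrows, namely `b`.

`δ` replaces the two arrows `a`, `b` by arrows along the segments between the head of `a`
and the tail of `b`, and between the head of `b` and the tail of `a`. So the new arrows are obtained
by exchanging the heads of the old ones. (Directing both new arrows the other way, from the old heads
to the old tails, gives the same ribbon graph, see `delta_from_heads_to_tails`.) -/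
def generatorPerm : Generator → Equiv.Perm ArrowEnd
  | .delta => Equiv.swap (false, true) (true, true)
  | .tau => Equiv.swap (true, false) (true, true)

theorem generatorPerm_rels :
    ∀ w ∈ ribbonRels, FreeGroup.lift generatorPerm w = 1 := by
  intro w hw
  simp only [ribbonRels, Set.mem_insert_iff, Set.mem_singleton_iff] at hw
  rcases hw with rfl | rfl | rfl <;> simp [generatorPerm] <;> decide

/-- The action of the twist group on the four arrow ends of an edge. -/
def twistPerm : TwistGroup →* Equiv.Perm ArrowEnd :=
  PresentedGroup.toGroup generatorPerm_rels

/-- Up to the symmetries of an edge, `δ` is the replacement of the arrows `a`, `b` by an arrow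
from the head of `a` to the tail of `b` (called `a`) and one from the head of `b` to the tail of `a`
(called `b`): the old heads become the tails, and the old tail of each arrow
becomes the head of the other one. -/
theorem delta_from_heads_to_tails : ∃ s r : Bool, ∀ x : Bool,
    (arrowSymm s r * generatorPerm .delta) (x, true) = (x, false) ∧
    (arrowSymm s r * generatorPerm .delta) (x, false) = (!x, true) := by
  decide

/-- `φ_π (γ) = γ ∘ π⁻¹`. -/
def permHom (n : ℕ) : Equiv.Perm (Fin n) →* MulAut (Fin n → TwistGroup) where
  toFun π :=
    { toFun := fun γ => γ ∘ ⇑π⁻¹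
      invFun := fun γ => γ ∘ ⇑π
      left_inv := fun γ => by ext1 i; simp
      right_inv := fun γ => by ext1 i; simp
      map_mul' := fun _ _ => rfl }
  map_one' := rfl
  map_mul' π₁ π₂ := by
    ext γ i
    simp

/-- The ribbon group: the semidirect product of `𝔖ⁿ` with the symmetric group, with product
`(γ₁, π₁) (γ₂, π₂) = (γ₁ · (γ₂ ∘ π₁⁻¹), π₁ π₂)`. -/
abbrev RibbonGroup (n : ℕ) : Type :=
  (Fin n → TwistGroup) ⋊[permHom n] (Equiv.Perm (Fin n))

/-- `(γ, π)` moves the edge in position `i` to position `π i`, and then applies `γ j` to the edge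
that is now in position `j`, for every `j`. -/
def pointPerm (n : ℕ) : RibbonGroup n →* Equiv.Perm (Point n) where
  toFun g := edgewise g.right (fun i => twistPerm (g.left i))
  map_one' := by ext1 p; simp
  map_mul' g h := by ext1 p; simp [permHom]

theorem exists_arrowSymm_conj (σ : Equiv.Perm ArrowEnd) (s r : Bool) :
    ∃ s' r' : Bool, σ * arrowSymm s r = arrowSymm s' r' * σ := by
  revert s r σ
  decide

theorem iso_relabel_pointPerm {n : ℕ} (g : RibbonGroup n) {P Q : ArrowPresentation n}
    (h : P.Iso Q) : (P.relabel (pointPerm n g)).Iso (Q.relabel (pointPerm n g)) := by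
  obtain ⟨s, r, rfl⟩ := h
  choose s' r' h' using fun i => exists_arrowSymm_conj (twistPerm (g.left i))
    (s (g.right⁻¹ i)) (r (g.right⁻¹ i))
  refine ⟨s', r', ?_⟩
  rw [relabel_relabel, relabel_relabel]
  congr 1
  ext1 p
  have := DFunLike.congr_fun (h' (g.right p.1)) p.2
  simpa [pointPerm] using this

/-- The ribbon group action `(γ, π) (G, ℓ) = γ (G, ℓ π⁻¹)` on ribbon graphs with ordered
edges. -/
instance ribbonAction (n : ℕ) : MulAction (RibbonGroup n) (OrderedRibbonGraph n) where
  smul g := Quotient.map (fun P => P.relabel (pointPerm n g))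
    (fun _ _ h => iso_relabel_pointPerm g h)
  one_smul G := by
    induction G using Quotient.inductionOn with
    | h P => exact congrArg (Quotient.mk _) (by simp [relabel_one])
  mul_smul g h G := by
    induction G using Quotient.inductionOn with
    | h P => exact congrArg (Quotient.mk _) (by simp [relabel_relabel])

/-- `G` is self-twual for the uniform tuple `(g, …, g)`: for some permutation `π` of the edges,
`((g, …, g), π) G = G`. -/
def IsSelfUniform {n : ℕ} (g : TwistGroup) (G : OrderedRibbonGraph n) : Prop :=
  ∃ π : Equiv.Perm (Fin n), (⟨fun _ => g, π⟩ : RibbonGroup n) • G = G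

/-- Isomorphic to the geometric dual. -/
def IsSelfDual {n : ℕ} (G : OrderedRibbonGraph n) : Prop := IsSelfUniform δ G

/-- Isomorphic to the Petrie dual. -/
def IsSelfPetrial {n : ℕ} (G : OrderedRibbonGraph n) : Prop := IsSelfUniform τ G

/-- Isomorphic to the trial. (Since `τδ` is the inverse of `δτ`, either of the two can be
used.) -/
def IsSelfTrial {n : ℕ} (G : OrderedRibbonGraph n) : Prop := IsSelfUniform (δ * τ) G

/-! ### The bouquets `H_k` -/

/-- The arrow presentation of an orientable ribbon graph with untwisted edges. The two ends of each
edge `i` are `(i, false)` and `(i, true)`, and `next` sends every edge end to the one following it on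
its circle; all arrows are directed along the circles. -/
def ofRotation {n : ℕ} (next : Equiv.Perm (Fin n × Bool)) : ArrowPresentation n where
  arc := Function.Involutive.toPerm
    (fun p => match p with
      | (i, x, true) => ((next (i, x)).1, (next (i, x)).2, false)
      | (i, x, false) => ((next⁻¹ (i, x)).1, (next⁻¹ (i, x)).2, true))
    (by rintro ⟨i, x, _ | _⟩ <;> simp)
  arc_arc := Function.Involutive.toPerm_involutive _
  arc_ne := by
    rintro ⟨i, x, _ | _⟩ h
    · exact absurd (congrArg (fun p : Point n => p.2.2) h) Bool.true_eq_false_eq_False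
    · exact absurd (congrArg (fun p : Point n => p.2.2) h) Bool.false_eq_true_eq_False
  bareCircles := 0

/-- The rotation of `H_k`. The edges `e_1, …, e_{3k}` are indexed by `Fin (3 * k)` (so `e_{i+1}`
has index `i`), and the indices are read modulo `3k`, `finRotate (3 * k)` being `i ↦ i + 1`.
With `(i, false)` the first and `(i, true)` the second of the two occurrences of `e_i` in the cyclic
pattern `e_2, e_1, e_3, e_2, e_4, e_3, …, e_{3k}, e_{3k-1}, e_1, e_{3k}` (where the block
`e_{i+1}, e_i` holds the first occurrence of `e_{i+1}` and the second one of `e_i`), the end following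
`(i, false)` is `(i - 1, true)`, and the end following `(i, true)` is `(i + 2, false)`. -/
def bouquetNext (k : ℕ) : Equiv.Perm (Fin (3 * k) × Bool) where
  toFun p := match p with
    | (i, false) => ((finRotate (3 * k)).symm i, true)
    | (i, true) => (finRotate (3 * k) (finRotate (3 * k) i), false)
  invFun p := match p with
    | (i, true) => (finRotate (3 * k) i, false)
    | (i, false) => ((finRotate (3 * k)).symm ((finRotate (3 * k)).symm i), true)
  left_inv := by
    rintro ⟨i, _ | _⟩ <;> simp only [Equiv.symm_apply_apply, Equiv.apply_symm_apply]
  right_inv := by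
    rintro ⟨i, _ | _⟩ <;> simp only [Equiv.symm_apply_apply, Equiv.apply_symm_apply]

/-- The bouquet `H_k` on `3k` untwisted edges, with its edge ordering. -/
def bouquet (k : ℕ) : OrderedRibbonGraph (3 * k) :=
  Quotient.mk _ (ofRotation (bouquetNext k))

/-- The tuple `(1, …, 1, δτ, …, δτ, τδ, …, τδ)`, each entry being repeated `k` times. -/
def alphaHat (k : ℕ) : Fin (3 * k) → TwistGroup := fun i =>
  if (i : ℕ) < k then 1 else if (i : ℕ) < 2 * k then δ * τ else τ * δ

end RibbonGraph

/-! The arcs of `H_k` join each edge `e_i` to `e_{i-2}`, `e_{i-1}`, `e_{i+1}`, `e_{i+2}`, so the medial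
graph of `H_k` is the circulant graph on `ℤ/3k` with steps `±1`, `±2`. If the twual of `H_k` by
`α` is self-twual for `(g, …, g)`, then the medial graph has an automorphism that acts on the four
arrow ends of the edge `i`, with image `π i`, as `(α (π i))⁻¹ g (α i)`, up to the symmetries of an
edge (`exists_isArcAutomorphism`).

*Self-trial.* Since `1`, `δτ`, `τδ` are the successive powers of `δτ`, the rotation by `k` satisfies
`α (i + k) = δτ · α i`, and rotations are automorphisms of `H_k`.

*Neither self-dual nor self-Petrial.* Both `δ` and `τ` act as odd permutations of the four arrow
ends, while the entries of `α` and the symmetries of an edge are even. So the automorphism would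
be odd at every edge, which is excluded as follows.

* For `k ≥ 3` the link of each vertex of the medial graph is a path with four vertices, whose two
  automorphisms are even (`IsArcAutomorphism.sign_eq_one`).
* For `k = 1` the medial graph is a triangle with doubled sides, and for `k = 2` it is the octahedron.
  In both cases the rotation by `3` commutes with all automorphisms, and a parity argument along
  the closed walk `i`, `i - 2`, `i - 4`, `i - 6` of length `3` applies
  (`IsArcAutomorphism.exists_sign_ne_neg_one`). -/

namespace RibbonGraph

/-! ### Powers of the rotation of `Fin n` -/

theorem finRotate_val_modEq {n : ℕ} (i : Fin n) :
    ((finRotate n i : ℕ) : ℤ) ≡ i + 1 [ZMOD n] := by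
  have := i.neZero
  rw [finRotate_apply, Fin.val_add, Fin.val_one']
  simp [Int.ModEq]

theorem finRotate_zpow_val_modEq {n : ℕ} (i : Fin n) (a : ℤ) :
    (((finRotate n ^ a) i : ℕ) : ℤ) ≡ i + a [ZMOD n] := by
  induction a using Int.induction_on with
  | zero => simp
  | succ m ih =>
    rw [add_comm, zpow_add, zpow_one, Equiv.Perm.mul_apply]
    refine (finRotate_val_modEq _).trans ((ih.add_right 1).trans ?_)
    rw [add_comm 1, add_assoc]
  | pred m ih =>
    have h := finRotate_val_modEq ((finRotate n ^ (-(m : ℤ) - 1)) i)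
    rw [← Equiv.Perm.mul_apply, ← zpow_one_add, add_sub_cancel] at h
    have h' := (h.symm.trans ih).sub_right 1
    rwa [add_sub_cancel_right, add_sub_assoc] at h'

theorem finRotate_zpow_apply_eq_iff {n : ℕ} (i : Fin n) (a b : ℤ) :
    (finRotate n ^ a) i = (finRotate n ^ b) i ↔ (n : ℤ) ∣ b - a := by
  have ha := finRotate_zpow_val_modEq i a
  have hb := finRotate_zpow_val_modEq i b
  constructor
  · intro h
    rw [h] at ha
    simpa using (ha.symm.trans hb).dvd
  · intro h
    have h' : ((i : ℤ) + a) ≡ i + b [ZMOD n] := (Int.modEq_of_dvd h).add_left _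
    have := Int.natCast_modEq_iff.1 (ha.trans (h'.trans hb.symm))
    exact Fin.ext (Nat.ModEq.eq_of_lt_of_lt this (Fin.isLt _) (Fin.isLt _))

theorem finRotate_pow_val {n : ℕ} (i : Fin n) (a : ℕ) :
    ((finRotate n ^ a) i : ℕ) = (i + a) % n := by
  have := finRotate_zpow_val_modEq i a
  rw [zpow_natCast] at this
  have := Int.natCast_modEq_iff.1 (by exact_mod_cast this)
  rwa [Nat.ModEq, Nat.mod_eq_of_lt (Fin.isLt _)] at this

/-! ### The arcs of the bouquets -/

/-- The arc of `H_k` that begins at the end `x` of an arrow of the edge `e_i` leads to the edge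
`e_{i + step x}`. -/
def step : ArrowEnd → ℤ
  | (false, false) => -2
  | (false, true) => -1
  | (true, false) => 1
  | (true, true) => 2

/-- The arc of `H_k` that begins at the arrow end `x` of some edge leads to the arrow end `mate x`
of another edge. -/
def mate (x : ArrowEnd) : ArrowEnd := (!x.1, !x.2)

theorem bouquet_arc (k : ℕ) (i : Fin (3 * k)) (x : ArrowEnd) :
    (ofRotation (bouquetNext k)).arc (i, x) = ((finRotate (3 * k) ^ step x) i, mate x) := by
  have h2 : ∀ i, (finRotate (3 * k) ^ (2 : ℤ)) i = finRotate _ (finRotate _ i) := fun i => by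
    rw [show (2 : ℤ) = 1 + 1 from rfl, zpow_add, zpow_one, Equiv.Perm.mul_apply]
  rcases x with ⟨_ | _, _ | _⟩
  · change ((finRotate (3 * k)).symm ((finRotate (3 * k)).symm i), true, true) = _
    simp only [step, mate, Prod.mk.injEq, Bool.not_false, and_true]
    rw [Equiv.symm_apply_eq, Equiv.symm_apply_eq, ← h2, ← Equiv.Perm.mul_apply, ← zpow_add]
    simp
  · change ((finRotate (3 * k)).symm i, true, false) = _
    simp [step, mate, Equiv.Perm.inv_def]
  · change (finRotate (3 * k) i, false, true) = _
    simp [step, mate]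
  · change (finRotate (3 * k) (finRotate (3 * k) i), false, false) = _
    simp only [step, mate, h2, Bool.not_true]

/-! ### Automorphisms of the arc system -/

/-- A permutation `π` of the edges, together with bijections `σ i` from the arrow ends of the edge
`i` to those of the edge `π i`, that respects the complementary arcs. It need not respect the
arrows: the `σ i` are arbitrary, so that this is an automorphism of the medial graph. -/
def IsArcAutomorphism {n : ℕ} (P : ArrowPresentation n) (π : Equiv.Perm (Fin n))
    (σ : Fin n → Equiv.Perm ArrowEnd) : Prop :=
  ∀ i x, P.arc (π i, σ i x) = (π (P.arc (i, x)).1, σ (P.arc (i, x)).1 (P.arc (i, x)).2)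

/-- The ribbon graph with ordered edges that is represented by an arrow presentation. -/
def ArrowPresentation.toGraph {n : ℕ} (P : ArrowPresentation n) : OrderedRibbonGraph n :=
  Quotient.mk _ P

/-- If the twual of `P` by `γ` is self-twual for the uniform tuple `(g, …, g)`, then `P` has an
arc automorphism which, on each edge `i` with image `π i`, is `(γ (π i))⁻¹ g (γ i)` up to the
symmetries of an edge. -/
theorem exists_isArcAutomorphism {n : ℕ} {g : TwistGroup} {γ : Fin n → TwistGroup}
    {P : ArrowPresentation n}
    (h : IsSelfUniform g ((⟨γ, 1⟩ : RibbonGroup n) • P.toGraph)) :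
    ∃ (π : Equiv.Perm (Fin n)) (s r : Fin n → Bool), IsArcAutomorphism P π fun i =>
      (twistPerm (γ (π i)))⁻¹ * arrowSymm (s i) (r i) * twistPerm g * twistPerm (γ i) := by
  obtain ⟨π, h⟩ := h
  obtain ⟨s, r, h⟩ := Quotient.exact h
  refine ⟨π, s ∘ π, r ∘ π, fun i x => ?_⟩
  have h := congrArg ArrowPresentation.arc h
  simp only [ArrowPresentation.relabel] at h
  set A := pointPerm n ⟨γ, 1⟩
  set B := pointPerm n ⟨fun _ => g, π⟩
  set C := edgewise 1 fun e => arrowSymm (s e) (r e)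
  have hφ : ∀ p : Point n, (A⁻¹ * C * B * A) p = (π p.1, ((twistPerm (γ (π p.1)))⁻¹ *
      arrowSymm (s (π p.1)) (r (π p.1)) * twistPerm g * twistPerm (γ p.1)) p.2) := by
    intro p
    simp only [mul_assoc]
    rw [Equiv.Perm.mul_apply, Equiv.Perm.inv_eq_iff_eq]
    simp [A, B, C, pointPerm]
  have hcomm : P.arc * (A⁻¹ * C * B * A) = (A⁻¹ * C * B * A) * P.arc := by
    have h' : A * P.arc * A⁻¹ * (C * B) = C * B * (A * P.arc * A⁻¹) := by
      refine (congrArg (· * (C * B)) h).trans ?_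
      group
    calc P.arc * (A⁻¹ * C * B * A) = A⁻¹ * (A * P.arc * A⁻¹ * (C * B)) * A := by group
      _ = _ := by rw [h']; group
  have := DFunLike.congr_fun hcomm (i, x)
  rw [Equiv.Perm.mul_apply, Equiv.Perm.mul_apply _ P.arc, hφ, hφ] at this
  exact this

theorem IsArcAutomorphism.apply_step {k : ℕ} {π : Equiv.Perm (Fin (3 * k))}
    {σ : Fin (3 * k) → Equiv.Perm ArrowEnd}
    (h : IsArcAutomorphism (ofRotation (bouquetNext k)) π σ) (i : Fin (3 * k)) (x : ArrowEnd) :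
    π ((finRotate (3 * k) ^ step x) i) = (finRotate (3 * k) ^ step (σ i x)) (π i) := by
  have := congrArg Prod.fst (h i x)
  simp only [bouquet_arc] at this
  exact this.symm

theorem IsArcAutomorphism.apply_mate {k : ℕ} {π : Equiv.Perm (Fin (3 * k))}
    {σ : Fin (3 * k) → Equiv.Perm ArrowEnd}
    (h : IsArcAutomorphism (ofRotation (bouquetNext k)) π σ) (i : Fin (3 * k)) (x : ArrowEnd) :
    σ ((finRotate (3 * k) ^ step x) i) (mate x) = mate (σ i x) := by
  have := congrArg Prod.snd (h i x)
  simp only [bouquet_arc] at this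
  exact this.symm

/-! ### Large bouquets -/

/-- Joining arrow ends whose steps differ by a step yields the path `-2, -1, 1, 2`. A permutation of
the arrow ends that preserves adjacency in this path is the identity or the reversal of the path, and
both are even. -/
theorem sign_eq_one_of_step (σ : Equiv.Perm ArrowEnd)
    (h : ∀ x y z, step x = step y + step z → ∃ w, step (σ x) = step (σ y) + step w) :
    Equiv.Perm.sign σ = 1 := by
  have key : ∀ σ : Equiv.Perm ArrowEnd, (∀ x y, (∃ z, step x = step y + step z) →
    ∃ w, step (σ x) = step (σ y) + step w) → Equiv.Perm.sign σ = 1 := by decide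
  exact key σ fun x y ⟨z, hz⟩ => h x y z hz

theorem step_bounds (x : ArrowEnd) : -2 ≤ step x ∧ step x ≤ 2 := by
  revert x; decide

/-- For `k ≥ 3` every arc automorphism of `H_k` is even on each edge: the link of a vertex of the
medial graph is a path, which is not the case for `k ≤ 2`. -/
theorem IsArcAutomorphism.sign_eq_one {k : ℕ} (hk : 3 ≤ k) {π : Equiv.Perm (Fin (3 * k))}
    {σ : Fin (3 * k) → Equiv.Perm ArrowEnd}
    (h : IsArcAutomorphism (ofRotation (bouquetNext k)) π σ) (i : Fin (3 * k)) :
    Equiv.Perm.sign (σ i) = 1 := by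
  refine sign_eq_one_of_step _ fun x y z hxyz => ?_
  have h1 := h.apply_step i x
  rw [hxyz, add_comm, zpow_add, Equiv.Perm.mul_apply, h.apply_step, h.apply_step,
    ← Equiv.Perm.mul_apply, ← zpow_add, finRotate_zpow_apply_eq_iff] at h1
  obtain ⟨c, hc⟩ := h1
  push_cast at hc
  have := step_bounds (σ i x)
  have := step_bounds (σ i y)
  have := step_bounds (σ ((finRotate (3 * k) ^ step y) i) z)
  -- both sides of the congruence modulo `3k ≥ 9` differ by at most `6`
  have hc0 : c = 0 := by
    rcases lt_trichotomy c 0 with h | h | h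
    · nlinarith
    · exact h
    · nlinarith
  refine ⟨σ ((finRotate (3 * k) ^ step y) i) z, ?_⟩
  rw [hc0, mul_zero] at hc
  linarith

/-! ### The bouquets with three and six edges -/

/-- If `3k` divides `6`, then an arc automorphism of `H_k` commutes with the rotation by `3`: this
rotation is the identity for `k = 1`, and for `k = 2` it maps each vertex of the medial graph, an
octahedron, to the only other vertex that is not adjacent to it. -/
theorem IsArcAutomorphism.apply_antipode {k : ℕ} (hk : 1 ≤ k) (hk2 : k ≤ 2)
    {π : Equiv.Perm (Fin (3 * k))} {σ : Fin (3 * k) → Equiv.Perm ArrowEnd}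
    (h : IsArcAutomorphism (ofRotation (bouquetNext k)) π σ) (i : Fin (3 * k)) :
    π ((finRotate _ ^ (3 : ℤ)) i) = (finRotate _ ^ (3 : ℤ)) (π i) := by
  interval_cases k
  · rw [show finRotate (3 * 1) ^ (3 : ℤ) = 1 by decide, Equiv.Perm.one_apply,
      Equiv.Perm.one_apply]
  · -- two vertices of the octahedron are equal, opposite or adjacent
    have htrans : ∀ u v : Fin (3 * 2), u = v ∨ u = (finRotate _ ^ (3 : ℤ)) v ∨
        ∃ x, u = (finRotate _ ^ step x) v := by decide
    have hne : ∀ j : Fin (3 * 2), (finRotate _ ^ (3 : ℤ)) j ≠ j := by decide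
    have hne' : ∀ y : ArrowEnd, ¬ ((3 * 2 : ℕ) : ℤ) ∣ step y - 3 := by decide
    rcases htrans (π ((finRotate _ ^ (3 : ℤ)) i)) (π i) with h0 | h3 | ⟨x, hx⟩
    · exact absurd (π.injective h0) (hne i)
    · exact h3
    · rw [← Equiv.apply_symm_apply (σ i) x, ← h.apply_step, π.apply_eq_iff_eq,
        finRotate_zpow_apply_eq_iff] at hx
      exact absurd hx (hne' _)

/-- The arcs that begin at the two tails, or at the two heads, of the arrows of an edge lead to
edges that differ by the rotation by `3`. So if `3k` divides `6`, then arc automorphisms respect the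
partition of the arrow ends of an edge into the pair of tails and the pair of heads. -/
theorem IsArcAutomorphism.apply_not_fst_snd {k : ℕ} (hk : 1 ≤ k) (hk2 : k ≤ 2)
    {π : Equiv.Perm (Fin (3 * k))} {σ : Fin (3 * k) → Equiv.Perm ArrowEnd}
    (h : IsArcAutomorphism (ofRotation (bouquetNext k)) π σ) (i : Fin (3 * k)) (x : ArrowEnd) :
    (σ i (!x.1, x.2)).2 = (σ i x).2 := by
  have hdvd : ∀ x : ArrowEnd, (6 : ℤ) ∣ 3 + step x - step (!x.1, x.2) := by decide
  have hsnd : ∀ y z : ArrowEnd, (3 : ℤ) ∣ 3 + step y - step z → z.2 = y.2 := by decide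
  have hk6 : ((3 * k : ℕ) : ℤ) ∣ 6 := by interval_cases k <;> decide
  refine hsnd _ _ ((Dvd.intro (k : ℤ) (by push_cast; rfl)).trans
    ((finRotate_zpow_apply_eq_iff (n := 3 * k) (π i) _ _).1 ?_))
  rw [← h.apply_step, zpow_add, Equiv.Perm.mul_apply, ← h.apply_step,
    ← h.apply_antipode hk hk2, ← Equiv.Perm.mul_apply (finRotate _ ^ (3 : ℤ)), ← zpow_add,
    (finRotate_zpow_apply_eq_iff i _ _).2 (hk6.trans (hdvd x))]

/-- If `3k` divides `6`, then an arc automorphism of `H_k` is not odd on all edges. If `σ i` is odd,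
then it exchanges the names of the two arrows on exactly one of the pair of tails and the pair of
heads. Since arcs join tails to heads, the edges with exchanged tails would alternate along the closed
walk `i`, `i - 2`, `i - 4`, `i - 6 = i` of length `3`. -/
theorem IsArcAutomorphism.exists_sign_ne_neg_one {k : ℕ} (hk : 1 ≤ k) (hk2 : k ≤ 2)
    {π : Equiv.Perm (Fin (3 * k))} {σ : Fin (3 * k) → Equiv.Perm ArrowEnd}
    (h : IsArcAutomorphism (ofRotation (bouquetNext k)) π σ) :
    ∃ i, Equiv.Perm.sign (σ i) ≠ -1 := by
  by_contra! hodd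
  have hlocal : ∀ ρ : Equiv.Perm ArrowEnd, Equiv.Perm.sign ρ = -1 →
      (∀ x, (ρ (!x.1, x.2)).2 = (ρ x).2) →
      (ρ (true, true)).1 = (ρ (false, false)).1 := by decide
  have hnext : ∀ i, (σ ((finRotate _ ^ (-2 : ℤ)) i) (false, false)).1 =
      !(σ i (false, false)).1 := fun i => by
    rw [← hlocal _ (hodd _) (h.apply_not_fst_snd hk hk2 _)]
    exact congrArg Prod.fst (h.apply_mate i (false, false))
  have hclosed : ∀ i : Fin (3 * k), (finRotate _ ^ (-2 : ℤ)) ((finRotate _ ^ (-2 : ℤ))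
      ((finRotate _ ^ (-2 : ℤ)) i)) = i := by
    interval_cases k <;> decide
  have h3 := hnext ((finRotate _ ^ (-2 : ℤ)) ((finRotate _ ^ (-2 : ℤ)) ⟨0, by omega⟩))
  rw [hclosed, hnext, hnext, Bool.not_not] at h3
  exact Bool.not_ne_self _ h3.symm

/-! ### The twist group -/

theorem delta_mul_self : δ * δ = 1 := by
  have : PresentedGroup.mk ribbonRels (FreeGroup.of .delta ^ 2) = 1 :=
    PresentedGroup.one_of_mem (by simp [ribbonRels])
  rwa [sq, map_mul] at this

theorem tau_mul_self : τ * τ = 1 := by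
  have : PresentedGroup.mk ribbonRels (FreeGroup.of .tau ^ 2) = 1 :=
    PresentedGroup.one_of_mem (by simp [ribbonRels])
  rwa [sq, map_mul] at this

theorem tau_mul_delta_pow_three : (τ * δ) ^ 3 = 1 := by
  have : PresentedGroup.mk ribbonRels ((FreeGroup.of .tau * FreeGroup.of .delta) ^ 3) = 1 :=
    PresentedGroup.one_of_mem (by simp [ribbonRels])
  rwa [map_pow, map_mul] at this

theorem delta_mul_tau_mul_tau_mul_delta : δ * τ * (τ * δ) = 1 := by
  rw [mul_assoc, ← mul_assoc τ, tau_mul_self, one_mul, delta_mul_self]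

theorem delta_mul_tau_mul_self : δ * τ * (δ * τ) = τ * δ := by
  have h : δ * τ = (τ * δ)⁻¹ := eq_inv_of_mul_eq_one_left delta_mul_tau_mul_tau_mul_delta
  have h3 := tau_mul_delta_pow_three
  rw [h, ← mul_inv_rev, inv_eq_iff_mul_eq_one, ← h3, pow_succ, pow_two]

theorem twistPerm_delta : twistPerm δ = generatorPerm .delta := PresentedGroup.toGroup.of _

theorem twistPerm_tau : twistPerm τ = generatorPerm .tau := PresentedGroup.toGroup.of _

theorem sign_arrowSymm (s r : Bool) : Equiv.Perm.sign (arrowSymm s r) = 1 := by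
  revert s r; decide

theorem sign_twistPerm_alphaHat {k : ℕ} (i : Fin (3 * k)) :
    Equiv.Perm.sign (twistPerm (alphaHat k i)) = 1 := by
  unfold alphaHat
  split_ifs <;> simp only [map_mul, map_one, twistPerm_delta, twistPerm_tau] <;> decide

/-! ### Self-twuality of the twisted bouquets -/

/-- No `g` that acts as an odd permutation of the four arrow ends makes the twisted bouquet
self-twual. -/
theorem not_isSelfUniform {k : ℕ} (hk : 1 ≤ k) {g : TwistGroup}
    (hg : Equiv.Perm.sign (twistPerm g) = -1) :
    ¬ IsSelfUniform g ((⟨alphaHat k, 1⟩ : RibbonGroup (3 * k)) • bouquet k) := by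
  intro h
  obtain ⟨π, s, r, h⟩ := exists_isArcAutomorphism (P := ofRotation (bouquetNext k)) h
  have hodd : ∀ i, Equiv.Perm.sign ((twistPerm (alphaHat k (π i)))⁻¹ * arrowSymm (s i) (r i) *
      twistPerm g * twistPerm (alphaHat k i)) = -1 := fun i => by
    simp [sign_twistPerm_alphaHat, sign_arrowSymm, hg]
  rcases Nat.lt_or_ge 2 k with hk3 | hk2
  · have h1 := h.sign_eq_one hk3 ⟨0, by omega⟩
    rw [hodd] at h1
    exact absurd h1 (by decide)
  · obtain ⟨i, hi⟩ := h.exists_sign_ne_neg_one hk hk2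
    exact hi (hodd i)

/-- The values `1`, `δτ`, `τδ` of `alphaHat k` on the three blocks are the successive powers of
`δτ`, which has order dividing `3`. -/
theorem alphaHat_rotate {k : ℕ} (i : Fin (3 * k)) :
    alphaHat k ((finRotate (3 * k) ^ k) i) = δ * τ * alphaHat k i := by
  have hi := i.isLt
  unfold alphaHat
  rw [finRotate_pow_val]
  rcases Nat.lt_or_ge (i : ℕ) (2 * k) with h2 | h2
  · rw [Nat.mod_eq_of_lt (by omega), if_neg (by omega), if_pos h2]
    rcases Nat.lt_or_ge (i : ℕ) k with h1 | h1
    · rw [if_pos (by omega), if_pos h1, mul_one]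
    · rw [if_neg (by omega), if_neg (by omega), delta_mul_tau_mul_self]
  · rw [Nat.mod_eq_sub_mod (by omega), Nat.mod_eq_of_lt (by omega), if_pos (by omega),
      if_neg (by omega), if_neg (by omega), delta_mul_tau_mul_tau_mul_delta]

theorem rotate_smul_bouquet (k m : ℕ) :
    (⟨1, finRotate (3 * k) ^ m⟩ : RibbonGroup (3 * k)) • bouquet k = bouquet k := by
  refine congrArg (Quotient.mk _) ?_
  ext1
  · change pointPerm _ _ * _ * (pointPerm _ _)⁻¹ = _
    rw [mul_inv_eq_iff_eq_mul]
    ext1 ⟨i, x⟩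
    simp only [Equiv.Perm.mul_apply, pointPerm, MonoidHom.coe_mk, OneHom.coe_mk, edgewise_apply,
      bouquet_arc, Pi.one_apply, map_one, Equiv.Perm.one_apply, Prod.mk.injEq, and_true]
    rw [← Equiv.Perm.mul_apply, ← Equiv.Perm.mul_apply, ← zpow_natCast,
      (Commute.refl (finRotate (3 * k))).zpow_zpow]
  · rfl

theorem isSelfTrial_twisted_bouquet (k : ℕ) :
    IsSelfTrial ((⟨alphaHat k, 1⟩ : RibbonGroup (3 * k)) • bouquet k) := by
  refine ⟨finRotate (3 * k) ^ k, ?_⟩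
  have hcomm : (⟨fun _ => δ * τ, finRotate (3 * k) ^ k⟩ : RibbonGroup (3 * k)) * ⟨alphaHat k, 1⟩ =
      ⟨alphaHat k, 1⟩ * ⟨1, finRotate (3 * k) ^ k⟩ := by
    refine SemidirectProduct.ext ?_ ?_
    · ext1 j
      have := alphaHat_rotate ((finRotate (3 * k) ^ k)⁻¹ j)
      rw [← Equiv.Perm.mul_apply, mul_inv_cancel, Equiv.Perm.one_apply] at this
      exact this.symm.trans (mul_one _).symm
    · exact (mul_one _).trans (one_mul _).symm
  rw [← mul_smul, hcomm, mul_smul, rotate_smul_bouquet]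

end RibbonGraph

theorem proposition7p1 (k : ℕ) (hk : 1 ≤ k) :
    RibbonGraph.IsSelfTrial
        ((⟨RibbonGraph.alphaHat k, 1⟩ : RibbonGraph.RibbonGroup (3 * k)) •
          RibbonGraph.bouquet k) ∧
      ¬ RibbonGraph.IsSelfDual
        ((⟨RibbonGraph.alphaHat k, 1⟩ : RibbonGraph.RibbonGroup (3 * k)) •
          RibbonGraph.bouquet k) ∧
      ¬ RibbonGraph.IsSelfPetrial
        ((⟨RibbonGraph.alphaHat k, 1⟩ : RibbonGraph.RibbonGroup (3 * k)) •
          RibbonGraph.bouquet k) := by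
  refine ⟨RibbonGraph.isSelfTrial_twisted_bouquet k, RibbonGraph.not_isSelfUniform hk ?_,
    RibbonGraph.not_isSelfUniform hk ?_⟩
  · rw [RibbonGraph.twistPerm_delta]; decide
  · rw [RibbonGraph.twistPerm_tau]; decide
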